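/- Let $n\ge 0$ be an integer. An instance $I$ of $\mathsf{CSP\!-\!2}$ on $n$ Boolean variables consists of a goal (maximize or minimize) and finitely many constraints $i=1,\dots,m$. Each constraint has a weight $w_i>0$, a support $J_i=(i_1<\dots<i_{k_i})$ of distinct indices in $\{1,\dots,n\}$, and an arbitrary function $P_i:\{0,1\}^{k_i}\to\mathbb{R}$. The objective is to optimize $v(I,x)=\sum_{i=1}^m w_iP_i(x_{J_i})$ over $x\in\{0,1\}^n$. The instance belongs to $\mathsf{k\,CSP\!-\!2}$ if $k_i\le k$ for all $i$. Write $\mathrm{opt}(I)$ and $\mathrm{wor}(I)$ for the best and the worst solution values (maximum and minimum of $v(I,\cdot)$ if the goal is to maximize, minimum and maximum if it is to minimize). When $\mathrm{opt}(I)\neq\mathrm{wor}(I)$, the average differential ratio of $I$ is $$\mathrm{avd}(I)=\frac{\mathbb{E}_X[v(I,X)]-\mathrm{wor}(I)}{\mathrm{opt}(I)-\mathrm{wor}(I)},$$ where $X$ is uniformly distributed over $\{0,1\}^n$. The strong chromatic number $\nu=\nu(I)$ is the smallest number of classes in a partition of $\{1,\dots,n\}$ into nonempty classes such that every support $J_i$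 meets every class in at most one index. Let $k\ge 4$ be an integer. For every $n$ and every instance $I$ of $\mathsf{k\,CSP\!-\!2}$ on $n$ variables with $\mathrm{opt}(I)\ne\mathrm{wor}(I)$ and $\nu=\nu(I)\ge k$: - if $k$ is even, then $$\mathrm{avd}(I)\ \ge\ \frac{1}{2^{\lceil\log_2(\nu+1)\rceil k/2}}\ \ge\ \frac{1}{(2\nu)^{k/2}};$$ - if $k$ is odd, then $$\mathrm{avd}(I)\ \ge\ \frac12\cdot\frac{1}{2^{\lceil\log_2\nu\rceil(k-1)/2}}\ \ge\ \frac12\cdot\frac{1}{(2\nu)^{(k-1)/2}}.$$ Moreover, there is a constant $C=C(k)>0$, depending only on $k$, such that $\mathrm{avd}(I)\ge C/n^{\lfloor k/2\rfloor}$ for every $n$ and every instance $I$ of $\mathsf{k\,CSP\!-\!2}$ on $n$ variables with $\mathrm{opt}(I)\ne\mathrm{wor}(I)$ and $\nu(I)\ge k$. -/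

import Mathlib

/-- The optimization goal of a CSP instance. -/
inductive OptGoal where
  | maximize
  | minimize

/-- A weighted constraint `w • P(x_{i₁}, …, x_{i_r})` on `n` variables over the alphabet
`Σ_q = {0, …, q-1}`, identified with `ℤ/qℤ`. Its support `(i₁, …, i_r)` is a subsequence of the
sequence of all variable indices, `P` is an arbitrary real-valued function, and `w > 0`. -/
structure WeightedConstraint (q n : ℕ) where
  arity : ℕ
  support : Fin arity ↪o Fin n
  P : (Fin arity → ZMod q) → ℝ
  weight : ℝ
  weight_pos : 0 < weight

/-- An instance of `CSP-q` with `n` variables: a goal and a finite sequence of weighted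
constraints. -/
structure CSPInstance (q n : ℕ) where
  goal : OptGoal
  numConstraints : ℕ
  constraint : Fin numConstraints → WeightedConstraint q n

namespace CSPInstance

/-- `I` is an instance of `k CSP-q`: every constraint involves at most `k` variables. -/
def IsKCSP {q n : ℕ} (I : CSPInstance q n) (k : ℕ) : Prop :=
  ∀ i, (I.constraint i).arity ≤ k

/-- The objective value `v(I, x) = ∑ i, w_i * P_i(x_{J_i})`. -/
noncomputable def value {q n : ℕ} (I : CSPInstance q n) (x : Fin n → ZMod q) : ℝ :=
  ∑ i, (I.constraint i).weight *
    (I.constraint i).P (fun j => x ((I.constraint i).support j))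

/-- The best solution value. -/
noncomputable def opt {q n : ℕ} (I : CSPInstance q n) : ℝ :=
  match I.goal with
  | OptGoal.maximize => ⨆ x, I.value x
  | OptGoal.minimize => ⨅ x, I.value x

/-- The worst solution value. -/
noncomputable def wor {q n : ℕ} (I : CSPInstance q n) : ℝ :=
  match I.goal with
  | OptGoal.maximize => ⨅ x, I.value x
  | OptGoal.minimize => ⨆ x, I.value x

/-- The expected value of a uniformly random solution. -/
noncomputable def averageValue {q n : ℕ} [NeZero q] (I : CSPInstance q n) : ℝ :=
  (∑ x : Fin n → ZMod q, I.value x) / (q : ℝ) ^ n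

/-- The differential ratio reached at the average solution value; it is meaningful only
when `I.opt ≠ I.wor`. -/
noncomputable def averageDifferentialRatio {q n : ℕ} [NeZero q] (I : CSPInstance q n) : ℝ :=
  (I.averageValue - I.wor) / (I.opt - I.wor)

/-- A strong coloring with `ν` colors, given as the map sending an index to its color: the color
classes are nonempty, and the support of any constraint meets each of them at most once. -/
def IsStrongColoring {q n : ℕ} (I : CSPInstance q n) {ν : ℕ} (c : Fin n → Fin ν) : Prop :=
  Function.Surjective c ∧
    ∀ i, Function.Injective (fun j => c ((I.constraint i).support j))

/-- `I` is `ν`-partite: there is a strong coloring of `I` with `ν` color classes. -/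
def IsPartite {q n : ℕ} (I : CSPInstance q n) (ν : ℕ) : Prop :=
  ∃ c : Fin n → Fin ν, I.IsStrongColoring c

/-- The smallest `ν` for which `I` is `ν`-partite. -/
noncomputable def strongChromaticNumber {q n : ℕ} (I : CSPInstance q n) : ℕ :=
  sInf {ν | I.IsPartite ν}

/-- Coloring all variables differently is a strong coloring, so the infimum above is a minimum. -/
theorem isPartite_self {q n : ℕ} (I : CSPInstance q n) : I.IsPartite n :=
  ⟨id, Function.surjective_id, fun i => (I.constraint i).support.injective⟩

end CSPInstance

/-!
Let `c` be a strong coloring with `ν` colors, let `V` be a finite vector space over `𝔽₂`, and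
attach to the colors vectors `g 1, …, g ν` of `V`, any `k` of which are linearly independent. For a
linear functional `φ` on `V`, shift a solution `x` to `x j + φ (g (c j))`. A constraint sees at most
`k` colors, each at most once, so as `φ` runs over the dual space the restriction of the shifted
solution to its support is uniformly distributed: the average value of the shifted solutions is the
average value of all solutions (`sum_value_shift`). In other words, the vectors `φ ∘ g` form an
orthogonal array of strength `k`. Taking `x` optimal, the zero functional contributes the optimum
and the other functionals at least the worst value, so that the average differential ratio is at
least `1 / |V|` (`one_div_card_le_averageDifferentialRatio`).

It remains to find a small `V`. The columns of the parity check matrix of the binary BCH code, the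
vectors `(a, a³, …, a^(2t-1))` for nonzero `a` in the field with `2^m` elements, are
such that any `2t` of them are independent: a vanishing sum of odd powers gives, by squaring, a
vanishing sum of all the powers `1, …, 2t`, contradicting Vandermonde. Adding a coordinate `1`
makes any `2t + 1` of them independent and allows `a = 0`. The smallest fields with at least `ν + 1`
and at least `ν` elements give the bounds for `k = 2t` and for `k = 2t + 1`.
-/

open Function Finset

/-! ### Pushing uniform averages forward along surjective homomorphisms -/

/-- Translating the argument of `f` shows that all translates `∑ a, h (f a + b)` are equal; summing
them over `b` avoids counting the fibers of `f`. -/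
theorem card_mul_sum_comp_of_surjective {A B : Type*} [AddCommGroup A] [AddCommGroup B]
    [Fintype A] [Fintype B] (f : A →+ B) (hf : Surjective f) (h : B → ℝ) :
    (Fintype.card B : ℝ) * ∑ a, h (f a) = Fintype.card A * ∑ b, h b := by
  have hshift (b : B) : ∑ a, h (f a + b) = ∑ a, h (f a) := by
    obtain ⟨a₀, rfl⟩ := hf b
    simpa only [map_add, Equiv.coe_addRight] using
      Equiv.sum_comp (Equiv.addRight a₀) (fun a => h (f a))
  calc (Fintype.card B : ℝ) * ∑ a, h (f a)
      = ∑ b : B, ∑ a, h (f a + b) := by simp [hshift]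
    _ = ∑ a : A, ∑ b, h (f a + b) := sum_comm
    _ = ∑ _a : A, ∑ b, h b := sum_congr rfl fun a _ => Equiv.sum_comp (Equiv.addLeft (f a)) h
    _ = Fintype.card A * ∑ b, h b := by simp

theorem LinearIndependent.surjective_dual_eval {K V ι : Type*} [Field K] [AddCommGroup V]
    [Module K V] [Fintype ι] {v : ι → V} (hv : LinearIndependent K v) (y : ι → K) :
    ∃ φ : Module.Dual K V, ∀ i, φ (v i) = y i := by
  classical
  obtain ⟨s, hs⟩ := (Fintype.linearCombination K v).exists_leftInverse_of_injective
    (LinearMap.ker_eq_bot.2 hv.fintypeLinearCombination_injective)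
  refine ⟨Fintype.linearCombination K y ∘ₗ s, fun i => ?_⟩
  have h := LinearMap.congr_fun hs (Pi.single i 1)
  rw [LinearMap.comp_apply, Fintype.linearCombination_apply_single, one_smul] at h
  rw [LinearMap.comp_apply, h]
  simp [Fintype.linearCombination_apply_single]

/-! ### Averaging over shifted solutions -/

namespace CSPInstance

theorem isPartite_strongChromaticNumber {q n : ℕ} (I : CSPInstance q n) :
    I.IsPartite I.strongChromaticNumber :=
  Nat.sInf_mem (s := {ν | I.IsPartite ν}) ⟨n, I.isPartite_self⟩

theorem strongChromaticNumber_le {q n : ℕ} (I : CSPInstance q n) :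
    I.strongChromaticNumber ≤ n :=
  Nat.sInf_le I.isPartite_self

variable {p n k ν : ℕ} [Fact p.Prime] {V : Type*} [AddCommGroup V] [Module (ZMod p) V]

/-- The shifts by the vectors `φ (g (c j))`, for all functionals `φ`, average the objective
exactly as all solutions do, because every constraint depends on at most `k` colors. -/
theorem sum_value_shift [Fintype (Module.Dual (ZMod p) V)] (I : CSPInstance p n)
    (hI : I.IsKCSP k) {c : Fin n → Fin ν} (hc : I.IsStrongColoring c) (g : Fin ν → V)
    (hg : ∀ r ≤ k, ∀ e : Fin r → Fin ν, Injective e → LinearIndependent (ZMod p) (g ∘ e))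
    (x : Fin n → ZMod p) :
    ∑ φ : Module.Dual (ZMod p) V, I.value (fun j => x j + φ (g (c j))) =
      Fintype.card (Module.Dual (ZMod p) V) * I.averageValue := by
  have hp : (p : ℝ) ≠ 0 := Nat.cast_ne_zero.2 (Fact.out : p.Prime).ne_zero
  rw [averageValue, mul_div_assoc', eq_div_iff (pow_ne_zero _ hp)]
  simp only [value]
  rw [sum_comm, sum_comm (s := (univ : Finset (Fin n → ZMod p))), sum_mul, mul_sum]
  refine sum_congr rfl fun i _ => ?_
  rcases hi : I.constraint i with ⟨r, s, P, w, _⟩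
  have hr : r ≤ k := by simpa [hi] using hI i
  have hinj : Injective fun j => c (s j) := by
    have := hc.2 i
    rw [hi] at this
    exact this
  -- Both averages are pushed forward to the uniform average over the values on the support.
  have h₁ := card_mul_sum_comp_of_surjective
    (AddMonoidHom.mk' (fun (φ : Module.Dual (ZMod p) V) (j : Fin r) => φ (g (c (s j))))
      fun _ _ => rfl)
    (fun y => ((hg r hr _ hinj).surjective_dual_eval y).imp fun _ h => funext h)
    (fun y => P (fun j => x (s j) + y j))
  have h₂ := card_mul_sum_comp_of_surjective
    (AddMonoidHom.mk' (fun (z : Fin n → ZMod p) (j : Fin r) => z (s j)) fun _ _ => rfl)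
    s.injective.surjective_comp_right P
  have h₃ : ∑ y : Fin r → ZMod p, P (fun j => x (s j) + y j) = ∑ y, P y :=
    Equiv.sum_comp (Equiv.addLeft fun j => x (s j)) P
  simp only [AddMonoidHom.mk'_apply, h₃, Fintype.card_fun, ZMod.card, Fintype.card_fin,
    Nat.cast_pow] at h₁ h₂
  simp only [← mul_sum]
  refine mul_left_cancel₀ (pow_ne_zero r hp) ?_
  linear_combination w * (p : ℝ) ^ n * h₁ -
    w * (Fintype.card (Module.Dual (ZMod p) V) : ℝ) * h₂

theorem exists_value_eq_opt {q : ℕ} [NeZero q] (I : CSPInstance q n) : ∃ x, I.value x = I.opt := by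
  rw [opt]
  cases I.goal
  · exact exists_eq_ciSup_of_finite
  · exact exists_eq_ciInf_of_finite

theorem one_div_card_le_averageDifferentialRatio [Finite V] (I : CSPInstance p n)
    (hI : I.IsKCSP k) (hne : I.opt ≠ I.wor) {c : Fin n → Fin ν} (hc : I.IsStrongColoring c)
    (g : Fin ν → V)
    (hg : ∀ r ≤ k, ∀ e : Fin r → Fin ν, Injective e → LinearIndependent (ZMod p) (g ∘ e)) :
    1 / (Nat.card V : ℝ) ≤ I.averageDifferentialRatio := by
  have : Finite (Module.Dual (ZMod p) V) := Module.finite_of_finite (ZMod p)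
  have : Fintype (Module.Dual (ZMod p) V) := Fintype.ofFinite _
  have hcard : Nat.card V = Fintype.card (Module.Dual (ZMod p) V) := by
    rw [← Nat.card_eq_fintype_card, Module.natCard_eq_pow_finrank (K := ZMod p) (V := V),
      Module.natCard_eq_pow_finrank (K := ZMod p) (V := Module.Dual (ZMod p) V),
      Subspace.dual_finrank_eq]
  obtain ⟨x, hx⟩ := I.exists_value_eq_opt
  have hsum := I.sum_value_shift hI hc g hg x
  rw [← hcard] at hsum
  have hN : (0 : ℝ) < Nat.card V := by exact_mod_cast Nat.card_pos
  have h0 : I.value (fun j => x j + (0 : Module.Dual (ZMod p) V) (g (c j))) = I.opt := by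
    simp [hx]
  rw [averageDifferentialRatio]
  have hconst : ∑ _φ : Module.Dual (ZMod p) V, I.wor = Nat.card V * I.wor := by
    rw [sum_const, card_univ, ← hcard, nsmul_eq_mul]
  -- Only the term of the zero functional is kept in the sum of the differences to the worst value.
  cases hgoal : I.goal with
  | maximize =>
    have hwor (y) : I.wor ≤ I.value y := by
      simp only [wor, hgoal]
      exact ciInf_le (Set.finite_range _).bddBelow y
    have hlt : 0 < I.opt - I.wor :=
      sub_pos.2 (lt_of_le_of_ne (hx ▸ hwor x) hne.symm)
    have hle := single_le_sum (s := univ)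
      (f := fun φ : Module.Dual (ZMod p) V => I.value (fun j => x j + φ (g (c j))) - I.wor)
      (fun φ _ => sub_nonneg.2 (hwor _)) (mem_univ 0)
    rw [sum_sub_distrib, hsum, hconst, h0] at hle
    rw [div_le_div_iff₀ hN hlt]
    linarith
  | minimize =>
    have hwor (y) : I.value y ≤ I.wor := by
      simp only [wor, hgoal]
      exact le_ciSup (Set.finite_range _).bddAbove y
    have hlt : 0 < I.wor - I.opt :=
      sub_pos.2 (lt_of_le_of_ne (hx ▸ hwor x) hne)
    have hle := single_le_sum (s := univ)
      (f := fun φ : Module.Dual (ZMod p) V => I.wor - I.value (fun j => x j + φ (g (c j))))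
      (fun φ _ => sub_nonneg.2 (hwor _)) (mem_univ 0)
    rw [sum_sub_distrib, hsum, hconst, h0] at hle
    rw [← neg_sub I.wor I.averageValue, ← neg_sub I.wor I.opt, neg_div_neg_eq,
      div_le_div_iff₀ hN hlt]
    linarith

end CSPInstance

/-! ### Binary BCH vectors -/

section BCH

variable {F : Type*} [Field F] [Algebra (ZMod 2) F] {t r : ℕ}

/-- In characteristic two, the power sum of exponent `2e` is the square of that of exponent `e`, so
the odd power sums control all of them. -/
theorem sum_smul_pow_eq_zero_of_odd {a : Fin r → F} {b : Fin r → ZMod 2}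
    (h : ∀ l < t, ∑ i, b i • a i ^ (2 * l + 1) = 0) :
    ∀ e, 1 ≤ e → e ≤ 2 * t → ∑ i, b i • a i ^ e = 0 := by
  have : CharP F 2 := charP_of_injective_algebraMap' (ZMod 2) 2
  intro e
  induction e using Nat.strong_induction_on with
  | _ e ih =>
    intro h1 h2
    obtain ⟨l, rfl | rfl⟩ := Nat.even_or_odd' e
    · have hsq := congrArg (· ^ 2) (ih l (by lia) (by lia) (by lia))
      simp only [sum_pow_char 2] at hsq
      rw [zero_pow two_ne_zero] at hsq
      rw [← hsq]
      refine sum_congr rfl fun i _ => ?_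
      rw [smul_pow, ← pow_mul, mul_comm l 2, ZMod.pow_card]
    · exact h l (by lia)

theorem linearIndependent_odd_powers {a : Fin r → F} (ha : Injective a) (ha0 : ∀ i, a i ≠ 0)
    (hr : r ≤ 2 * t) :
    LinearIndependent (ZMod 2) fun (i : Fin r) (l : Fin t) => a i ^ (2 * (l : ℕ) + 1) := by
  rw [Fintype.linearIndependent_iff]
  intro b hb
  have hpow := sum_smul_pow_eq_zero_of_odd (a := a) (b := b) (t := t) fun l hl => by
    simpa using congrFun hb ⟨l, hl⟩
  have hv := Matrix.eq_zero_of_forall_pow_sum_mul_pow_eq_zero (f := a)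
    (v := fun i => b i • a i) ha fun j => by
      rw [← hpow (j + 1) (by lia) (by have := j.2; lia)]
      exact sum_congr rfl fun i _ => by rw [smul_mul_assoc, pow_succ']
  intro i
  exact (smul_eq_zero.1 (congrFun hv i)).resolve_right (ha0 i)

theorem linearIndependent_one_odd_powers {a : Fin r → F} (ha : Injective a)
    (hr : r ≤ 2 * t + 1) :
    LinearIndependent (ZMod 2) fun i : Fin r =>
      ((1, fun l => a i ^ (2 * (l : ℕ) + 1)) : ZMod 2 × (Fin t → F)) := by
  rw [Fintype.linearIndependent_iff]
  intro b hb
  have hpow := sum_smul_pow_eq_zero_of_odd (a := a) (b := b) (t := t) fun l hl => by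
    simpa [Prod.snd_sum] using congrFun (congrArg Prod.snd hb) ⟨l, hl⟩
  have hzero : ∑ i, b i • (1 : F) = 0 := by
    have h := congrArg Prod.fst hb
    simp only [Prod.fst_sum, Prod.smul_fst, smul_eq_mul, mul_one, Prod.fst_zero] at h
    rw [← sum_smul, h, zero_smul]
  have hv := Matrix.eq_zero_of_forall_pow_sum_mul_pow_eq_zero (f := a)
    (v := fun i => b i • (1 : F)) ha fun j => by
      rcases Nat.eq_zero_or_pos (j : ℕ) with hj | hj
      · simpa [hj] using hzero
      · rw [← hpow j hj (by have := j.2; lia)]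
        exact sum_congr rfl fun i _ => by rw [smul_mul_assoc, one_mul]
  intro i
  exact (smul_eq_zero.1 (congrFun hv i)).resolve_right one_ne_zero

end BCH

/-! ### The bounds -/

namespace CSPInstance

variable {n t m : ℕ}

theorem one_div_two_pow_le_averageDifferentialRatio (I : CSPInstance 2 n) (hI : I.IsKCSP (2 * t))
    (hne : I.opt ≠ I.wor) (hm : m ≠ 0) (hν : I.strongChromaticNumber + 1 ≤ 2 ^ m) :
    1 / (2 : ℝ) ^ (m * t) ≤ I.averageDifferentialRatio := by
  obtain ⟨c, hc⟩ := I.isPartite_strongChromaticNumber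
  have : Finite (GaloisField 2 m) := Nat.finite_of_card_ne_zero (by simp [GaloisField.card 2 m hm])
  have : Fintype (GaloisField 2 m) := Fintype.ofFinite _
  classical
  have hF : Fintype.card (GaloisField 2 m) = 2 ^ m := by
    rw [← Nat.card_eq_fintype_card, GaloisField.card 2 m hm]
  obtain ⟨a⟩ : Nonempty (Fin I.strongChromaticNumber ↪ (GaloisField 2 m)ˣ) := by
    refine Function.Embedding.nonempty_of_card_le ?_
    rw [Fintype.card_units, hF, Fintype.card_fin]
    lia
  have h := I.one_div_card_le_averageDifferentialRatio hI hne hc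
    (fun i (l : Fin t) => (a i : GaloisField 2 m) ^ (2 * (l : ℕ) + 1))
    fun r hr e he => linearIndependent_odd_powers
      (Units.val_injective.comp (a.injective.comp he)) (fun i => (a (e i)).ne_zero) hr
  simpa [Nat.card_pi, hF, ← pow_mul] using h

theorem half_mul_one_div_two_pow_le_averageDifferentialRatio (I : CSPInstance 2 n)
    (hI : I.IsKCSP (2 * t + 1)) (hne : I.opt ≠ I.wor) (hm : m ≠ 0)
    (hν : I.strongChromaticNumber ≤ 2 ^ m) :
    1 / 2 * (1 / (2 : ℝ) ^ (m * t)) ≤ I.averageDifferentialRatio := by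
  obtain ⟨c, hc⟩ := I.isPartite_strongChromaticNumber
  have : Finite (GaloisField 2 m) := Nat.finite_of_card_ne_zero (by simp [GaloisField.card 2 m hm])
  have : Fintype (GaloisField 2 m) := Fintype.ofFinite _
  have hF : Fintype.card (GaloisField 2 m) = 2 ^ m := by
    rw [← Nat.card_eq_fintype_card, GaloisField.card 2 m hm]
  obtain ⟨a⟩ : Nonempty (Fin I.strongChromaticNumber ↪ GaloisField 2 m) := by
    refine Function.Embedding.nonempty_of_card_le ?_
    rwa [hF, Fintype.card_fin]
  have h := I.one_div_card_le_averageDifferentialRatio hI hne hc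
    (fun i => ((1, fun l => a i ^ (2 * (l : ℕ) + 1)) : ZMod 2 × (Fin t → GaloisField 2 m)))
    fun r hr e he => linearIndependent_one_odd_powers (a.injective.comp he) hr
  rw [one_div_mul_one_div]
  simpa [Nat.card_prod, Nat.card_pi, hF, ← pow_mul] using h

end CSPInstance

theorem le_two_pow_ceil_logb {N : ℕ} (hN : 0 < N) : N ≤ 2 ^ ⌈Real.logb 2 (N : ℝ)⌉₊ := by
  have h := Nat.le_ceil (Real.logb 2 (N : ℝ))
  rw [Real.logb_le_iff_le_rpow one_lt_two (by exact_mod_cast hN), Real.rpow_natCast] at h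
  exact_mod_cast h

theorem two_pow_ceil_logb_lt {N : ℕ} (hN : 0 < N) : 2 ^ ⌈Real.logb 2 (N : ℝ)⌉₊ < 2 * N := by
  have h := Nat.ceil_lt_add_one (Real.logb_nonneg one_lt_two (x := (N : ℝ)) (by exact_mod_cast hN))
  have hN' : (0 : ℝ) < N := by exact_mod_cast hN
  rw [← sub_lt_iff_lt_add, Real.lt_logb_iff_rpow_lt one_lt_two hN',
    Real.rpow_sub_one two_ne_zero, Real.rpow_natCast, div_lt_iff₀ two_pos] at h
  rw [mul_comm]
  exact_mod_cast h

theorem ceil_logb_ne_zero {N : ℕ} (hN : 2 ≤ N) : ⌈Real.logb 2 (N : ℝ)⌉₊ ≠ 0 := by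
  intro h
  have := le_two_pow_ceil_logb (N := N) (by lia)
  rw [h] at this
  lia

theorem one_div_pow_le_one_div_two_pow_mul {m N : ℕ} (t : ℕ) (h : 2 ^ m ≤ 2 * N) :
    1 / (2 * (N : ℝ)) ^ t ≤ 1 / (2 : ℝ) ^ (m * t) := by
  rw [pow_mul]
  have h' : (2 : ℝ) ^ m ≤ 2 * N := by exact_mod_cast h
  gcongr

theorem mainTheorem4 (k : ℕ) (hk : 4 ≤ k) :
    (∀ (n : ℕ) (I : CSPInstance 2 n),
      I.IsKCSP k → k ≤ I.strongChromaticNumber → I.opt ≠ I.wor →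
        (Even k →
          1 / (2 : ℝ) ^ (⌈Real.logb 2 ((I.strongChromaticNumber : ℝ) + 1)⌉₊ * (k / 2))
              ≤ I.averageDifferentialRatio ∧
          1 / (2 * (I.strongChromaticNumber : ℝ)) ^ (k / 2)
              ≤ 1 / (2 : ℝ) ^ (⌈Real.logb 2 ((I.strongChromaticNumber : ℝ) + 1)⌉₊ * (k / 2))) ∧
        (Odd k →
          1 / 2 * (1 / (2 : ℝ) ^ (⌈Real.logb 2 (I.strongChromaticNumber : ℝ)⌉₊ * ((k - 1) / 2)))
              ≤ I.averageDifferentialRatio ∧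
          1 / 2 * (1 / (2 * (I.strongChromaticNumber : ℝ)) ^ ((k - 1) / 2))
              ≤ 1 / 2 *
                (1 / (2 : ℝ) ^ (⌈Real.logb 2 (I.strongChromaticNumber : ℝ)⌉₊ * ((k - 1) / 2))))) ∧
    (∃ C : ℝ, 0 < C ∧ ∀ (n : ℕ) (I : CSPInstance 2 n),
      I.IsKCSP k → k ≤ I.strongChromaticNumber → I.opt ≠ I.wor →
        C / (n : ℝ) ^ (k / 2) ≤ I.averageDifferentialRatio) := by
  rw [and_iff_left_of_imp]
  · intro n I hI hν hne
    refine ⟨fun hk2 => ?_, fun hk2 => ?_⟩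
    · obtain ⟨t, rfl⟩ := hk2.two_dvd
      rw [Nat.mul_div_cancel_left t two_pos, ← Nat.cast_add_one]
      refine ⟨I.one_div_two_pow_le_averageDifferentialRatio hI hne
        (ceil_logb_ne_zero (by lia)) (le_two_pow_ceil_logb (by lia)),
        one_div_pow_le_one_div_two_pow_mul t ?_⟩
      -- The power of two below `2 * (ν + 1)` is even, hence at most `2 * ν`.
      have hlt := two_pow_ceil_logb_lt (N := I.strongChromaticNumber + 1) (by lia)
      obtain ⟨d, hd⟩ := dvd_pow_self 2 (ceil_logb_ne_zero (N := I.strongChromaticNumber + 1)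
        (by lia))
      rw [hd] at hlt ⊢
      lia
    · obtain ⟨t, rfl⟩ := hk2
      rw [Nat.add_sub_cancel, Nat.mul_div_cancel_left t two_pos]
      exact ⟨I.half_mul_one_div_two_pow_le_averageDifferentialRatio hI hne
        (ceil_logb_ne_zero (by lia)) (le_two_pow_ceil_logb (by lia)),
        mul_le_mul_of_nonneg_left (one_div_pow_le_one_div_two_pow_mul t
          (two_pow_ceil_logb_lt (by lia)).le) (by norm_num)⟩
  · intro h
    refine ⟨1 / 2 * (1 / 2 ^ (k / 2)), by positivity, fun n I hI hν hne => ?_⟩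
    have hpos : (0 : ℝ) < I.strongChromaticNumber := by
      exact_mod_cast lt_of_lt_of_le (by lia : 0 < k) hν
    have hn : (I.strongChromaticNumber : ℝ) ≤ n := by exact_mod_cast I.strongChromaticNumber_le
    calc 1 / 2 * (1 / 2 ^ (k / 2)) / (n : ℝ) ^ (k / 2)
        = 1 / 2 * (1 / (2 * (n : ℝ)) ^ (k / 2)) := by rw [mul_pow]; ring
      _ ≤ 1 / 2 * (1 / (2 * (I.strongChromaticNumber : ℝ)) ^ (k / 2)) := by gcongr
      _ ≤ I.averageDifferentialRatio := by
        rcases Nat.even_or_odd k with hk2 | hk2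
        · have h2 := (h n I hI hν hne).1 hk2
          refine le_trans ?_ (h2.2.trans h2.1)
          exact mul_le_of_le_one_left (by positivity) (by norm_num)
        · have h2 := (h n I hI hν hne).2 hk2
          have hdiv : k / 2 = (k - 1) / 2 := by
            obtain ⟨t, rfl⟩ := hk2
            lia
          rw [hdiv]
          exact h2.2.trans h2.1
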